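/- Let $d\ge 1$ and let $\mathbb{M}=\mathbb{R}^{1+d}$ be Minkowski spacetime with the form $x^2=x_0^2-x_1^2-\dots-x_d^2$. A region is an open, bounded, causally convex subset $O\subset\mathbb{M}$, and $O^\perp$ denotes the set of points spacelike separated from every point of $O$. Let $\mathcal{A}$ be a unital C$^*$-algebra with closed unital $^*$-subalgebras $\mathcal{A}(O)\subseteq\mathcal{A}$, one for every region $O$, and with a group homomorphism $x\mapsto\delta_x$ from $(\mathbb{R}^{1+d},+)$ to the $^*$-automorphisms of $\mathcal{A}$ (no continuity is assumed), such that (i) $\mathcal{A}$ is the norm closure of $\bigcup_O\mathcal{A}(O)$; (ii) $O_1\subseteq O_2$ implies $\mathcal{A}(O_1)\subseteq\mathcal{A}(O_2)$ (isotony); (iii) $O_1\subseteq O_2^\perp$ implies that $\mathcal{A}(O_1)$ and $\mathcal{A}(O_2)$ commute (locality); (iv) $\delta_x(\mathcal{A}(O))=\mathcal{A}(O+x)$ for all $x$ and $O$ (translation covariance). For a state $\varphi$ on $\mathcal{A}$ let $(\pi_\varphi,\mathcal{H}_\varphi,\Omega_\varphi)$ be its GNS representation and $\mathcal{M}_\varphi=\pi_\varphi(\mathcal{A})''$.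 The state $\varphi$ is primary if $\mathcal{M}_\varphi\cap\mathcal{M}_\varphi'=\mathbb{C}\mathbf{1}$, and $\Omega_\varphi$ is separating if $X\in\mathcal{M}_\varphi$ and $X\Omega_\varphi=0$ imply $X=0$. The folium of $\varphi$ is the set of states of the form $\operatorname{tr}(\rho\,\pi_\varphi(\cdot))$ with $\rho$ a density operator (positive, trace class, of unit trace) on $\mathcal{H}_\varphi$. Two states are disjoint if their folia have empty intersection. **Theorem.** Let $u,w\in\mathbb{R}^{1+d}$ be linearly independent future-directed timelike vectors, and let $\sigma\neq\omega$ be two states on $\mathcal{A}$ such that $\sigma\circ\delta_{tu}=\sigma$ and $\omega\circ\delta_{tw}=\omega$ for all $t\in\mathbb{R}$. Assume that $\sigma$ and $\omega$ are primary, that they are mixing for their respective time evolutions, i.e. $$\lim_{t\to\infty}\sigma(B\,\delta_{tu}(A))=\sigma(A)\sigma(B),\qquad \lim_{t\to\infty}\omega(B\,\delta_{tw}(A))=\omega(A)\omega(B)\qquad\text{for all }A,B\in\mathcal{A},$$ and that $\Omega_\sigma$ and $\Omega_\omega$ are separating for $\mathcal{M}_\sigma$ and $\mathcal{M}_\omega$,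 respectively. Then $\sigma$ and $\omega$ are disjoint. -/

import Mathlib

open scoped ComplexOrder InnerProductSpace Topology

/-! ### Minkowski spacetime -/

/-- `(1 + d)`-dimensional Minkowski spacetime as the set `ℝ^{1+d}`; coordinate `0` is time. -/
abbrev Minkowski (d : ℕ) : Type := Fin (d + 1) → ℝ

namespace Minkowski

variable {d : ℕ}

/-- The Minkowski square in signature `(+, -, …, -)`. -/
def sq (x : Minkowski d) : ℝ := x 0 ^ 2 - ∑ i : Fin d, x i.succ ^ 2

/-- Future-directed timelike vectors. -/
def IsFutureTimelike (x : Minkowski d) : Prop := 0 < sq x ∧ 0 < x 0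

/-- Spacelike vectors. -/
def IsSpacelike (x : Minkowski d) : Prop := sq x < 0

/-- `y` lies in the causal future `J⁺(x)` of `x` (equivalently `x ∈ J⁻(y)`). -/
def CausallyPrecedes (x y : Minkowski d) : Prop := 0 ≤ sq (y - x) ∧ x 0 ≤ y 0

/-- `O` is causally convex: it contains `J⁺(x) ∩ J⁻(y)`, the union of all causal curves
from `x` to `y`, for all `x, y ∈ O`. -/
def CausallyConvex (O : Set (Minkowski d)) : Prop :=
  ∀ x ∈ O, ∀ y ∈ O, ∀ z, CausallyPrecedes x z → CausallyPrecedes z y → z ∈ O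

/-- The causal complement: all points that are spacelike separated from every point of `O`. -/
def causalComplement (O : Set (Minkowski d)) : Set (Minkowski d) :=
  {x | ∀ y ∈ O, IsSpacelike (x - y)}

end Minkowski

/-- A region: an open, bounded, causally convex subset of Minkowski spacetime. -/
structure Region (d : ℕ) where
  carrier : Set (Minkowski d)
  isOpen : IsOpen carrier
  isBounded : Bornology.IsBounded carrier
  causallyConvex : Minkowski.CausallyConvex carrier

/-- The translated region `O + x = {y + x : y ∈ O}`. -/
def Region.translate {d : ℕ} (O : Region d) (x : Minkowski d) : Region d where
  carrier := (fun y => y + x) '' O.carrier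
  isOpen := (Homeomorph.addRight x).isOpenMap _ O.isOpen
  isBounded := by
    obtain ⟨C, hC⟩ := O.isBounded.exists_norm_le
    refine isBounded_iff_forall_norm_le.2 ⟨C + ‖x‖, ?_⟩
    rintro _ ⟨y, hy, rfl⟩
    exact (norm_add_le y x).trans (by linarith [hC y hy])
  causallyConvex := by
    rintro _ ⟨a, ha, rfl⟩ _ ⟨b, hb, rfl⟩ z ⟨h1, h2⟩ ⟨h3, h4⟩
    refine ⟨z - x, O.causallyConvex a ha b hb (z - x) ⟨?_, ?_⟩ ⟨?_, ?_⟩, sub_add_cancel z x⟩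
    · rwa [show z - x - a = z - (a + x) by abel]
    · simp only [Pi.add_apply, Pi.sub_apply] at h2 ⊢; linarith
    · rwa [show b - (z - x) = b + x - z by abel]
    · simp only [Pi.add_apply, Pi.sub_apply] at h4 ⊢; linarith

/-! ### Local, translation-covariant quantum field theories -/

/-- A local, translation-covariant quantum field theory on `(1 + d)`-dimensional Minkowski
spacetime with quasi-local algebra `A`. The local algebras are unital C⋆-subalgebras of `A`, and
`A` is the norm closure of their union. -/
structure LocalQFT (d : ℕ) (A : Type*) [CStarAlgebra A] where
  /-- The local observable algebras. -/
  localAlgebra : Region d → StarSubalgebra ℂ A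
  isClosed : ∀ O, IsClosed (localAlgebra O : Set A)
  /-- `A` is the quasi-local algebra. -/
  quasiLocal : closure (⋃ O, (localAlgebra O : Set A)) = Set.univ
  isotony : ∀ O₁ O₂ : Region d, O₁.carrier ⊆ O₂.carrier → localAlgebra O₁ ≤ localAlgebra O₂
  locality : ∀ O₁ O₂ : Region d, O₁.carrier ⊆ Minkowski.causalComplement O₂.carrier →
    ∀ a ∈ localAlgebra O₁, ∀ b ∈ localAlgebra O₂, a * b = b * a
  /-- The action of the additive group of spacetime translations by ⋆-automorphisms. -/
  translation : Multiplicative (Minkowski d) →* (A ≃⋆ₐ[ℂ] A)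
  covariance : ∀ (O : Region d) (x : Minkowski d),
    translation (Multiplicative.ofAdd x) '' (localAlgebra O : Set A) =
      (localAlgebra (O.translate x) : Set A)

/-- The one-parameter group `t ↦ δ_{t u}` of ⋆-automorphisms: time evolution along `u`. -/
def LocalQFT.timeEvolution {d : ℕ} {A : Type*} [CStarAlgebra A] (Q : LocalQFT d A)
    (u : Minkowski d) : Multiplicative ℝ →* (A ≃⋆ₐ[ℂ] A) where
  toFun t := Q.translation (Multiplicative.ofAdd (t.toAdd • u))
  map_one' := by simp
  map_mul' s t := by simp [add_smul]

/-! ### States, GNS representations, induced von Neumann algebras -/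

/-- A state: a positive, normalized linear functional on a unital C⋆-algebra. -/
structure State (A : Type*) [CStarAlgebra A] [PartialOrder A] extends A →ₚ[ℂ] ℂ where
  map_one' : toFun 1 = 1

namespace State

universe u

variable {A : Type u} [CStarAlgebra A] [PartialOrder A]

noncomputable instance : CoeFun (State A) (fun _ => A → ℂ) := ⟨fun ω => ω.toPositiveLinearMap⟩

/-- `ω` is invariant under the one-parameter group `α`. -/
def IsInvariant (ω : State A) (α : Multiplicative ℝ →* (A ≃⋆ₐ[ℂ] A)) : Prop :=
  ∀ (t : ℝ) (a : A), ω (α (Multiplicative.ofAdd t) a) = ω a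

/-- The mixing property: `ω(b α_t(a)) → ω(a) ω(b)` as `t → ∞`. -/
def IsMixing (ω : State A) (α : Multiplicative ℝ →* (A ≃⋆ₐ[ℂ] A)) : Prop :=
  ∀ a b : A, Filter.Tendsto (fun t : ℝ => ω (b * α (Multiplicative.ofAdd t) a)) Filter.atTop
    (𝓝 (ω a * ω b))

variable [StarOrderedRing A]

/-- The GNS Hilbert space. -/
abbrev GNSSpace (ω : State A) : Type u := ω.toPositiveLinearMap.GNS

/-- The GNS representation. -/
noncomputable abbrev gnsRep (ω : State A) : A →⋆ₐ[ℂ] (ω.GNSSpace →L[ℂ] ω.GNSSpace) :=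
  ω.toPositiveLinearMap.gnsStarAlgHom

/-- The GNS vector: the class of the unit element. -/
noncomputable def gnsVector (ω : State A) : ω.GNSSpace :=
  ((ω.toPositiveLinearMap.toPreGNS 1 : ω.toPositiveLinearMap.PreGNS) : ω.GNSSpace)

/-- The von Neumann algebra `π_ω(A)''` induced by `ω`. -/
noncomputable def inducedVN (ω : State A) : VonNeumannAlgebra ω.GNSSpace where
  toStarSubalgebra := StarSubalgebra.centralizer ℂ
    (StarSubalgebra.centralizer ℂ (Set.range ω.gnsRep) : Set (ω.GNSSpace →L[ℂ] ω.GNSSpace))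
  centralizer_centralizer' := by
    simp

/-- `ω` is primary: `π_ω(A)''` is a factor, i.e. has center `ℂ 1`. -/
def IsPrimary (ω : State A) : Prop :=
  (ω.inducedVN : Set (ω.GNSSpace →L[ℂ] ω.GNSSpace)) ∩ ω.inducedVN.commutant =
    Set.range (fun c : ℂ => c • (1 : ω.GNSSpace →L[ℂ] ω.GNSSpace))

/-- The GNS vector is separating for `π_ω(A)''`. -/
def HasSeparatingGNSVector (ω : State A) : Prop :=
  ∀ X ∈ ω.inducedVN, X ω.gnsVector = 0 → X = 0

end State

/-! ### Folia and disjointness -/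

/-- `T` has trace `t`: for every orthonormal basis, the sum of the diagonal matrix elements of `T`
converges (unconditionally) to `t`. -/
def HasTrace {H : Type*} [NormedAddCommGroup H] [InnerProductSpace ℂ H]
    (T : H →L[ℂ] H) (t : ℂ) : Prop :=
  ∀ (s : Set H) (b : HilbertBasis s ℂ H), HasSum (fun i => ⟪b i, T (b i)⟫_ℂ) t

/-- Density operators: positive trace class operators of unit trace. -/
structure IsDensityOperator {H : Type*} [NormedAddCommGroup H] [InnerProductSpace ℂ H]
    [CompleteSpace H] (ρ : H →L[ℂ] H) : Prop where
  isPositive : ρ.IsPositive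
  hasTrace_one : HasTrace ρ 1

namespace State

variable {A : Type*} [CStarAlgebra A] [PartialOrder A] [StarOrderedRing A]

/-- The folium of `ω`: all states `tr(ρ π_ω(·))` with `ρ` a density operator on the GNS space. -/
def folium (ω : State A) : Set (State A) :=
  {φ | ∃ ρ : ω.GNSSpace →L[ℂ] ω.GNSSpace, IsDensityOperator ρ ∧
    ∀ a : A, HasTrace (ρ * ω.gnsRep a) (φ a)}

/-- Two states are disjoint if their folia are disjoint. -/
def AreDisjoint (σ ω : State A) : Prop := σ.folium ∩ ω.folium = ∅

end State

/-! A mixing state attracts everything its folium can see. Suppose `φ` lies in both folia. Mixing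
makes the bounded operators `δ_{tw}(a) - ω(a)1` tend weakly to zero on `Ω_ω`, and the separating
property spreads this to all of `H_ω` (`HasSeparatingGNSVector.isWeaklyNull`). Normality carries the
convergence to `φ`, and from `φ` it reaches a nonzero cyclic subspace of `H_σ`. Since `σ` is
primary, it then holds on all of `H_σ` (`IsWeaklyNull.of_mem_folium`, `IsPrimary.isWeaklyNull`).
Hence `σ(δ_{tw} a) → ω(a)` and, by symmetry, `ω(δ_{tu} a) → σ(a)`.

The two evolutions commute, so the limit `σ` of `ω ∘ δ_{tu}` inherits the `w`-invariance of `ω`.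
Then `σ(δ_{tw} a)` is constant in `t`, and its limit gives `σ = ω`, a contradiction. -/

open ContinuousLinearMap Filter

/-! ### Hilbert–Schmidt operators and the trace -/

section HilbertSchmidt

variable {H ι : Type*} [NormedAddCommGroup H] [InnerProductSpace ℂ H]

theorem HilbertBasis.hasSum_norm_inner_sq (b : HilbertBasis ι ℂ H) (x : H) :
    HasSum (fun i => ‖⟪b i, x⟫_ℂ‖ ^ 2) (‖x‖ ^ 2) := by
  have h := Complex.hasSum_re (b.hasSum_inner_mul_inner x x)
  convert! h using 1
  · funext i
    rw [← inner_conj_symm x (b i), mul_comm, Complex.mul_conj, Complex.normSq_eq_norm_sq,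
      Complex.ofReal_re]
  · rw [inner_self_eq_norm_sq_to_K, ← RCLike.ofReal_pow]
    exact (Complex.ofReal_re _).symm

theorem ENNReal.tsum_ofReal_eq_of_hasSum {α : Type*} {f : α → ℝ} {s : ℝ} (hf : ∀ i, 0 ≤ f i)
    (h : HasSum f s) : ∑' i, ENNReal.ofReal (f i) = ENNReal.ofReal s := by
  rw [← h.tsum_eq, ENNReal.ofReal_tsum_of_nonneg hf h.summable]

theorem hasSum_of_tsum_ofReal_eq {α : Type*} {f : α → ℝ} {s : ℝ} (hf : ∀ i, 0 ≤ f i)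
    (hs : 0 ≤ s) (h : ∑' i, ENNReal.ofReal (f i) = ENNReal.ofReal s) : HasSum f s := by
  have h1 : ∑' i, ENNReal.ofReal (f i) ≠ ⊤ := h ▸ ENNReal.ofReal_ne_top
  have h2 := ENNReal.hasSum_toReal h1
  rw [← ENNReal.tsum_toReal_eq fun _ => ENNReal.ofReal_ne_top, h, ENNReal.toReal_ofReal hs] at h2
  simpa [ENNReal.toReal_ofReal, hf] using h2

/-- Polarization with explicit scalars, so that both sides of the trace identity can be expanded
over the same four coefficients. The companion version conjugates them, as passing to adjoints does.
-/
theorem inner_eq_sum_norm_add_smul_sq (x y : H) :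
    ⟪x, y⟫_ℂ = (((‖x + (1 : ℂ) • y‖ ^ 2 : ℝ) : ℂ) - (‖x + (-1 : ℂ) • y‖ ^ 2 : ℝ) +
      (((‖x + (-Complex.I) • y‖ ^ 2 : ℝ) : ℂ) - (‖x + Complex.I • y‖ ^ 2 : ℝ)) * Complex.I) / 4 := by
  simpa [← sub_eq_add_neg] using inner_eq_sum_norm_sq_div_four (𝕜 := ℂ) x y

theorem inner_eq_sum_star_norm_add_smul_sq (x y : H) :
    ⟪y, x⟫_ℂ = (((‖x + star (1 : ℂ) • y‖ ^ 2 : ℝ) : ℂ) - (‖x + star (-1 : ℂ) • y‖ ^ 2 : ℝ) +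
      (((‖x + star (-Complex.I) • y‖ ^ 2 : ℝ) : ℂ) - (‖x + star Complex.I • y‖ ^ 2 : ℝ)) *
        Complex.I) / 4 := by
  rw [← inner_conj_symm, inner_eq_sum_norm_add_smul_sq]
  simp only [map_div₀, map_add, map_sub, map_mul, Complex.conj_ofReal, Complex.conj_I,
    Complex.conj_ofNat, star_one, star_neg, Complex.star_def, neg_neg]
  ring

variable [CompleteSpace H]

/-- The Hilbert–Schmidt norms of an operator and of its adjoint agree. -/
theorem HilbertBasis.hasSum_norm_adjoint_sq (b : HilbertBasis ι ℂ H) (Z : H →L[ℂ] H) {s : ℝ}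
    (h : HasSum (fun i => ‖Z (b i)‖ ^ 2) s) : HasSum (fun i => ‖adjoint Z (b i)‖ ^ 2) s := by
  refine hasSum_of_tsum_ofReal_eq (fun _ => by positivity)
    (h.nonneg fun _ => by positivity) ?_
  rw [← ENNReal.tsum_ofReal_eq_of_hasSum (fun _ => by positivity) h]
  -- Parseval turns both sides into double series of squared matrix elements. Working in `ENNReal`
  -- lets the sums be exchanged without summability conditions.
  simp_rw [← fun x : H => ENNReal.tsum_ofReal_eq_of_hasSum (fun _ => by positivity)
    (b.hasSum_norm_inner_sq x)]
  rw [ENNReal.tsum_comm]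
  refine tsum_congr fun i => tsum_congr fun j => ?_
  rw [adjoint_inner_right, norm_inner_symm]

/-- Cyclicity of the trace for a Hilbert–Schmidt operator `r`: `tr (r² T) = tr (r T r)`. -/
theorem HilbertBasis.hasSum_inner_conj (b : HilbertBasis ι ℂ H) {r : H →L[ℂ] H}
    (hr : adjoint r = r) (hs : Summable fun i => ‖r (b i)‖ ^ 2) (T : H →L[ℂ] H) {t : ℂ}
    (ht : HasSum (fun i => ⟪b i, (r * r * T) (b i)⟫_ℂ) t) :
    HasSum (fun i => ⟪r (b i), T (r (b i))⟫_ℂ) t := by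
  -- `r + c r T` and `r + c̄ T* r` are adjoint to each other, so their Hilbert–Schmidt norms agree.
  -- Polarizing over `c = ±1, ±i` gives the trace identity.
  have key (c : ℂ) : ∃ s : ℝ, HasSum (fun i => ‖r (b i) + c • r (T (b i))‖ ^ 2) s ∧
      HasSum (fun i => ‖r (b i) + star c • adjoint T (r (b i))‖ ^ 2) s := by
    have hsum : Summable fun i => ‖(r + star c • (adjoint T * r)) (b i)‖ ^ 2 := by
      refine (hs.mul_left ((1 + ‖star c • adjoint T‖) ^ 2)).of_nonneg_of_le
        (fun _ => by positivity) fun i => ?_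
      rw [← mul_pow]
      refine pow_le_pow_left₀ (norm_nonneg _) ?_ 2
      calc ‖(r + star c • (adjoint T * r)) (b i)‖
          = ‖r (b i) + (star c • adjoint T) (r (b i))‖ := by simp
        _ ≤ ‖r (b i)‖ + ‖star c • adjoint T‖ * ‖r (b i)‖ :=
          (norm_add_le _ _).trans (by gcongr; exact le_opNorm _ _)
        _ = _ := by ring
    obtain ⟨s, hs'⟩ := hsum
    refine ⟨s, ?_, by simpa using hs'⟩
    have := b.hasSum_norm_adjoint_sq _ hs'
    have hadj : adjoint (r + star c • (adjoint T * r)) = r + c • (r * T) := by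
      simp only [← star_eq_adjoint] at hr ⊢
      simp [hr]
    rw [hadj] at this
    simpa using this
  obtain ⟨s₁, h₁, k₁⟩ := key 1
  obtain ⟨s₂, h₂, k₂⟩ := key (-1)
  obtain ⟨s₃, h₃, k₃⟩ := key Complex.I
  obtain ⟨s₄, h₄, k₄⟩ := key (-Complex.I)
  have comb {f₁ f₂ f₃ f₄ : ι → ℝ} (h₁ : HasSum f₁ s₁) (h₂ : HasSum f₂ s₂) (h₃ : HasSum f₃ s₃)
      (h₄ : HasSum f₄ s₄) :
      HasSum (fun i => ((f₁ i : ℂ) - f₂ i + ((f₄ i : ℂ) - f₃ i) * Complex.I) / 4)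
        (((s₁ : ℂ) - s₂ + ((s₄ : ℂ) - s₃) * Complex.I) / 4) := by
    have e {f : ι → ℝ} {s : ℝ} (h : HasSum f s) : HasSum (fun i => (f i : ℂ)) (s : ℂ) :=
      Complex.hasSum_ofReal.2 h
    exact (((e h₁).sub (e h₂)).add (((e h₄).sub (e h₃)).mul_right Complex.I)).div_const 4
  have hl := comb h₁ h₂ h₃ h₄
  have hr' := comb k₁ k₂ k₃ k₄
  have el (i : ι) : ⟪b i, (r * r * T) (b i)⟫_ℂ = ⟪r (b i), r (T (b i))⟫_ℂ := by
    rw [← hr, adjoint_inner_left, hr]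
    rfl
  simp_rw [el, inner_eq_sum_norm_add_smul_sq] at ht
  simp_rw [← adjoint_inner_left T, inner_eq_sum_star_norm_add_smul_sq]
  rw [ht.unique hl]
  exact hr'

/-- With `r` the positive square root, the diagonal elements of `ρ` are `‖r (b i)‖²`, so unit trace
means unit Hilbert–Schmidt norm. -/
theorem IsDensityOperator.exists_sqrt {ρ : H →L[ℂ] H} (hρ : IsDensityOperator ρ) :
    ∃ r : H →L[ℂ] H, adjoint r = r ∧ ρ = r * r ∧
      ∀ (s : Set H) (b : HilbertBasis s ℂ H), HasSum (fun i => ‖r (b i)‖ ^ 2) 1 := by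
  have hpos : 0 ≤ ρ := (nonneg_iff_isPositive ρ).2 hρ.isPositive
  have hr : adjoint (CFC.sqrt ρ) = CFC.sqrt ρ := by
    rw [← star_eq_adjoint]
    exact (IsSelfAdjoint.of_nonneg (CFC.sqrt_nonneg ρ)).star_eq
  have hmul := (CFC.sqrt_mul_sqrt_self ρ hpos).symm
  refine ⟨CFC.sqrt ρ, hr, hmul, fun s b => ?_⟩
  have h := Complex.hasSum_re (hρ.hasTrace_one s b)
  convert! h using 1
  funext i
  conv_rhs => rw [hmul, mul_apply_eq_comp, ← adjoint_inner_left, hr, inner_self_eq_norm_sq_to_K]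
  rw [← RCLike.ofReal_pow]
  exact (Complex.ofReal_re _).symm

end HilbertSchmidt

/-! ### Weak convergence to zero of bounded families -/

section WeaklyNull

variable {H : Type*} [NormedAddCommGroup H] [InnerProductSpace ℂ H]

/-- The vectors on which the operators `T t` tend weakly to zero as `t → ∞`. -/
def weaklyNullVectors (T : ℝ → H →L[ℂ] H) : Submodule ℂ H where
  carrier := {ξ | ∀ η, Tendsto (fun t => ⟪η, T t ξ⟫_ℂ) atTop (𝓝 0)}
  add_mem' ha hb η := by simpa [inner_add_right] using (ha η).add (hb η)
  zero_mem' η := by simp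
  smul_mem' c x hx η := by simpa [inner_smul_right] using (hx η).const_mul c

/-- A function that is uniformly approximated by functions tending to zero tends to zero. -/
theorem tendsto_zero_of_forall_approx {f : ℝ → ℂ}
    (h : ∀ ε > 0, ∃ g : ℝ → ℂ, Tendsto g atTop (𝓝 0) ∧ ∀ t, ‖f t - g t‖ ≤ ε) :
    Tendsto f atTop (𝓝 0) := by
  rw [Metric.tendsto_atTop]
  intro ε hε
  obtain ⟨g, hg, hfg⟩ := h (ε / 2) (half_pos hε)
  obtain ⟨N, hN⟩ := Metric.tendsto_atTop.1 hg (ε / 2) (half_pos hε)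
  refine ⟨N, fun t ht => ?_⟩
  have h1 := hN t ht
  rw [dist_zero_right] at h1 ⊢
  calc ‖f t‖ = ‖(f t - g t) + g t‖ := by rw [sub_add_cancel]
    _ ≤ ‖f t - g t‖ + ‖g t‖ := norm_add_le _ _
    _ < ε := by linarith [hfg t]

theorem isClosed_weaklyNullVectors {T : ℝ → H →L[ℂ] H} {C : ℝ} (hC : ∀ t, ‖T t‖ ≤ C) :
    IsClosed (weaklyNullVectors T : Set H) := by
  refine isClosed_of_closure_subset fun ξ hξ η => tendsto_zero_of_forall_approx fun ε hε => ?_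
  have hC0 : 0 ≤ C := (norm_nonneg _).trans (hC 0)
  -- The `+ 1` keeps the denominator positive when `η` or `C` vanishes.
  obtain ⟨ζ, hζ, hd⟩ := Metric.mem_closure_iff.1 hξ (ε / (‖η‖ * C + 1)) (by positivity)
  refine ⟨_, hζ η, fun t => ?_⟩
  rw [dist_eq_norm, lt_div_iff₀ (by positivity)] at hd
  rw [← inner_sub_right, ← map_sub]
  calc ‖⟪η, T t (ξ - ζ)⟫_ℂ‖ ≤ ‖η‖ * (C * ‖ξ - ζ‖) := (norm_inner_le_norm _ _).trans
        (by gcongr; exact (le_opNorm _ _).trans (by gcongr; exact hC t))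
    _ ≤ ‖ξ - ζ‖ * (‖η‖ * C + 1) := by nlinarith [norm_nonneg (ξ - ζ)]
    _ ≤ ε := hd.le

/-- Weak convergence to zero of a bounded family of vectors can be tested on a dense set. -/
theorem tendsto_inner_zero_of_dense {x : ℝ → H} {C : ℝ} (hC : ∀ t, ‖x t‖ ≤ C) {D : Set H}
    (hD : Dense D) (h : ∀ η ∈ D, Tendsto (fun t => ⟪η, x t⟫_ℂ) atTop (𝓝 0)) (η : H) :
    Tendsto (fun t => ⟪η, x t⟫_ℂ) atTop (𝓝 0) := by
  refine tendsto_zero_of_forall_approx fun ε hε => ?_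
  have hC0 : 0 ≤ C := (norm_nonneg _).trans (hC 0)
  obtain ⟨ζ, hζ, hd⟩ := Metric.mem_closure_iff.1 (hD η) (ε / (C + 1)) (by positivity)
  refine ⟨_, h ζ hζ, fun t => ?_⟩
  rw [dist_eq_norm, lt_div_iff₀ (by positivity)] at hd
  rw [← inner_sub_left]
  calc ‖⟪η - ζ, x t⟫_ℂ‖ ≤ ‖η - ζ‖ * C := (norm_inner_le_norm _ _).trans (by gcongr; exact hC t)
    _ ≤ ‖η - ζ‖ * (C + 1) := by nlinarith [norm_nonneg (η - ζ)]
    _ ≤ ε := hd.le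

end WeaklyNull

/-! ### Folia, GNS representations and their commutants -/

namespace State

variable {A : Type*} [CStarAlgebra A] [PartialOrder A] [StarOrderedRing A]

/-- A state in the folium of `ω` is given by a square summable family of vectors. -/
theorem exists_hasSum_of_mem_folium {ω φ : State A} (h : φ ∈ ω.folium) :
    ∃ (s : Set ω.GNSSpace) (ξ : s → ω.GNSSpace), HasSum (fun i => ‖ξ i‖ ^ 2) 1 ∧
      ∀ a : A, HasSum (fun i => ⟪ξ i, ω.gnsRep a (ξ i)⟫_ℂ) (φ a) := by
  obtain ⟨ρ, hρ, htr⟩ := h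
  obtain ⟨r, hr, rfl, hsum⟩ := hρ.exists_sqrt
  obtain ⟨s, b, -⟩ := exists_hilbertBasis ℂ ω.GNSSpace
  exact ⟨s, fun i => r (b i), hsum s b, fun a =>
    b.hasSum_inner_conj hr (hsum s b).summable _ (htr a s b)⟩

theorem gnsRep_gnsVector (ω : State A) (a : A) :
    ω.gnsRep a ω.gnsVector = (ω.toPositiveLinearMap.toPreGNS a : ω.GNSSpace) := by
  simp [gnsRep, gnsVector]

theorem inner_toPreGNS (ω : State A) (a b : A) :
    ⟪(ω.toPositiveLinearMap.toPreGNS a : ω.GNSSpace), ω.toPositiveLinearMap.toPreGNS b⟫_ℂ =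
      ω (star a * b) := by
  rw [UniformSpace.Completion.inner_coe, PositiveLinearMap.preGNS_inner_def]
  rfl

theorem inner_gnsVector_gnsRep (ω : State A) (a : A) :
    ⟪ω.gnsVector, ω.gnsRep a ω.gnsVector⟫_ℂ = ω a := by
  rw [gnsRep_gnsVector, gnsVector, inner_toPreGNS, star_one, one_mul]

theorem dense_range_toPreGNS (ω : State A) :
    Dense (Set.range fun a : A => (ω.toPositiveLinearMap.toPreGNS a : ω.GNSSpace)) :=
  UniformSpace.Completion.denseRange_coe.comp
    ω.toPositiveLinearMap.toPreGNS.surjective.denseRange (UniformSpace.Completion.continuous_coe _)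

theorem norm_gnsRep_le (ω : State A) (a : A) : ‖ω.gnsRep a‖ ≤ ‖a‖ :=
  NonUnitalStarAlgHom.norm_apply_le ω.gnsRep a

/-- The range of the representation is already closed under adjoints, so the star-closed centralizer
is the plain one. -/
theorem coe_inducedVN (ω : State A) :
    (ω.inducedVN : Set (ω.GNSSpace →L[ℂ] ω.GNSSpace)) =
      Set.centralizer (Set.centralizer (Set.range ω.gnsRep)) := by
  have hstar : star (Set.range ω.gnsRep) = Set.range ω.gnsRep := by
    ext X
    simp only [Set.mem_star, Set.mem_range]
    exact ⟨fun ⟨a, ha⟩ => ⟨star a, by rw [map_star, ha, star_star]⟩,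
      fun ⟨a, ha⟩ => ⟨star a, by rw [map_star, ha]⟩⟩
  have h := StarSubalgebra.coe_centralizer_centralizer (R := ℂ) (Set.range ω.gnsRep)
  rw [hstar, Set.union_self] at h
  exact h

theorem gnsRep_mem_inducedVN (ω : State A) (a : A) : ω.gnsRep a ∈ ω.inducedVN := by
  rw [← SetLike.mem_coe, coe_inducedVN]
  exact Set.subset_centralizer_centralizer ⟨a, rfl⟩

theorem mem_commutant_inducedVN_iff {ω : State A} {X : ω.GNSSpace →L[ℂ] ω.GNSSpace} :
    X ∈ ω.inducedVN.commutant ↔ ∀ a, ω.gnsRep a * X = X * ω.gnsRep a := by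
  rw [← SetLike.mem_coe, VonNeumannAlgebra.coe_commutant, coe_inducedVN,
    Set.centralizer_centralizer_centralizer, Set.mem_centralizer_iff]
  simp only [Set.forall_mem_range]

theorem commute_gnsRep {ω : State A} {X : ω.GNSSpace →L[ℂ] ω.GNSSpace}
    (hX : X ∈ ω.inducedVN.commutant) (a : A) (ξ : ω.GNSSpace) :
    X (ω.gnsRep a ξ) = ω.gnsRep a (X ξ) := by
  have := VonNeumannAlgebra.mem_commutant_iff.1 hX _ (ω.gnsRep_mem_inducedVN a)
  exact (congr($this ξ)).symm

theorem inner_gnsRep (ω : State A) (a : A) (ξ η : ω.GNSSpace) :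
    ⟪η, ω.gnsRep a ξ⟫_ℂ = ⟪ω.gnsRep (star a) η, ξ⟫_ℂ := by
  rw [map_star, star_eq_adjoint, adjoint_inner_left]

/-! ### Transfer of weak convergence between representations -/

/-- The operators of a family `a t` of observables tend weakly to zero in the GNS representation
of `ω`. -/
def IsWeaklyNull (ω : State A) (a : ℝ → A) : Prop :=
  weaklyNullVectors (fun t => ω.gnsRep (a t)) = ⊤

theorem mem_weaklyNullVectors_commutant {ω : State A} {X : ω.GNSSpace →L[ℂ] ω.GNSSpace}
    (hX : X ∈ ω.inducedVN.commutant) {a : ℝ → A} {ξ : ω.GNSSpace}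
    (hξ : ξ ∈ weaklyNullVectors fun t => ω.gnsRep (a t)) :
    X ξ ∈ weaklyNullVectors fun t => ω.gnsRep (a t) := by
  intro η
  simpa only [← commute_gnsRep hX, adjoint_inner_left] using hξ (adjoint X η)

/-- The commutant is closed under adjoints, so a subspace invariant under it is reducing. Its
projection thus commutes with the commutant and lies in the bicommutant. -/
theorem starProjection_mem_inducedVN {ω : State A} (K : Submodule ℂ ω.GNSSpace)
    [K.HasOrthogonalProjection] (hK : ∀ X ∈ ω.inducedVN.commutant, ∀ ξ ∈ K, X ξ ∈ K) :
    K.starProjection ∈ ω.inducedVN := by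
  rw [VonNeumannAlgebra.IsStarProjection.mem_iff isStarProjection_starProjection]
  intro X hX
  rw [Submodule.range_starProjection]
  exact hK X hX

/-- If the GNS vector is separating, it is cyclic for the commutant, hence convergence on it
implies convergence on the GNS space. -/
theorem HasSeparatingGNSVector.isWeaklyNull {ω : State A} (hω : ω.HasSeparatingGNSVector)
    {a : ℝ → A} {C : ℝ} (hC : ∀ t, ‖a t‖ ≤ C)
    (h : ∀ b : A, Tendsto (fun t => ω (b * a t)) atTop (𝓝 0)) : ω.IsWeaklyNull a := by
  have hC' (t : ℝ) : ‖ω.gnsRep (a t)‖ ≤ C := (ω.norm_gnsRep_le _).trans (hC t)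
  set S := weaklyNullVectors fun t => ω.gnsRep (a t)
  have hcl : IsClosed (S : Set ω.GNSSpace) := isClosed_weaklyNullVectors hC'
  have : CompleteSpace S := hcl.completeSpace_coe
  have hΩ : ω.gnsVector ∈ S := by
    refine tendsto_inner_zero_of_dense (C := C * ‖ω.gnsVector‖)
      (fun t => (le_opNorm _ _).trans (by gcongr; exact hC' t)) ω.dense_range_toPreGNS ?_
    rintro _ ⟨b, rfl⟩
    simp only [gnsRep_gnsVector, inner_toPreGNS]
    exact h (star b)
  have hP : S.starProjection ∈ ω.inducedVN :=
    starProjection_mem_inducedVN S fun X hX ξ hξ => mem_weaklyNullVectors_commutant hX hξ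
  -- `1 - P` belongs to the von Neumann algebra and kills `Ω`, so the separating property forces it
  -- to vanish.
  have h1 : 1 - S.starProjection = 0 := by
    refine hω _ (sub_mem (one_mem _) hP) ?_
    simp [Submodule.starProjection_eq_self_iff.2 hΩ]
  refine Submodule.eq_top_iff'.2 fun ξ => ?_
  rw [← Submodule.starProjection_eq_self_iff, ← sub_eq_zero.1 h1, one_apply_eq_self]

/-- Normal states are compatible with weak limits of bounded families. -/
theorem IsWeaklyNull.tendsto_of_mem_folium {ω φ : State A} {a : ℝ → A} (ha : ω.IsWeaklyNull a)
    {C : ℝ} (hC : ∀ t, ‖a t‖ ≤ C) (hφ : φ ∈ ω.folium) (b c : A) :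
    Tendsto (fun t => φ (b * a t * c)) atTop (𝓝 0) := by
  obtain ⟨s, ξ, hξ, hsum⟩ := exists_hasSum_of_mem_folium hφ
  have hC0 : 0 ≤ C := (norm_nonneg _).trans (hC 0)
  simp_rw [← fun x => (hsum x).tsum_eq]
  rw [← tsum_zero (α := ℂ) (β := s)]
  refine tendsto_tsum_of_dominated_convergence
    (bound := fun i => ‖b‖ * C * ‖c‖ * ‖ξ i‖ ^ 2) (hξ.summable.mul_left _) (fun i => ?_)
    (Eventually.of_forall fun t i => ?_)
  · simp only [map_mul, mul_apply_eq_comp]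
    simp only [ω.inner_gnsRep b]
    exact ((Submodule.eq_top_iff'.1 ha) (ω.gnsRep c (ξ i))) _
  · calc ‖⟪ξ i, ω.gnsRep (b * a t * c) (ξ i)⟫_ℂ‖
        ≤ ‖ξ i‖ * (‖b * a t * c‖ * ‖ξ i‖) := (norm_inner_le_norm _ _).trans
          (by gcongr; exact (le_opNorm _ _).trans (by gcongr; exact ω.norm_gnsRep_le _))
      _ ≤ ‖ξ i‖ * ((‖b‖ * C * ‖c‖) * ‖ξ i‖) := by
          gcongr
          exact (norm_mul_le _ _).trans
            (by gcongr; exact (norm_mul_le _ _).trans (by gcongr; exact hC t))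
      _ = _ := by ring

/-- A linear functional that is bounded with respect to the GNS seminorm of `φ` is a limit of
functionals `φ (b ⬝)`, hence inherits their convergence on bounded families. -/
theorem tendsto_of_le_gns (φ : State A) (f : A →ₗ[ℂ] ℂ) {c : ℝ}
    (hf : ∀ a, ‖f a‖ ≤ c * ‖φ.toPositiveLinearMap.toPreGNS a‖) {x : ℝ → A} {C : ℝ}
    (hC : ∀ t, ‖φ.toPositiveLinearMap.toPreGNS (x t)‖ ≤ C)
    (hx : ∀ b, Tendsto (fun t => φ (b * x t)) atTop (𝓝 0)) :
    Tendsto (fun t => f (x t)) atTop (𝓝 0) := by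
  let g : φ.toPositiveLinearMap.PreGNS →L[ℂ] ℂ :=
    (f ∘ₗ φ.toPositiveLinearMap.ofPreGNS.toLinearMap).mkContinuous c fun a => hf _
  let G : φ.GNSSpace →L[ℂ] ℂ := g.extend UniformSpace.Completion.toComplL
  have hG (a : A) : G (φ.toPositiveLinearMap.toPreGNS a : φ.GNSSpace) = f a :=
    g.extend_eq UniformSpace.Completion.denseRange_coe
      (UniformSpace.Completion.isUniformInducing_coe _) _
  -- The Riesz vector `v` need not come from `A`. By density it suffices to test against classes of
  -- elements `b`, where the pairing is `φ (star b * ⬝)`.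
  obtain ⟨v, hv⟩ := (InnerProductSpace.toDual ℂ φ.GNSSpace).surjective G
  have hGv (y : φ.GNSSpace) : G y = ⟪v, y⟫_ℂ := by
    rw [← hv, InnerProductSpace.toDual_apply_apply]
  simp_rw [← hG, hGv]
  refine tendsto_inner_zero_of_dense (C := C)
    (fun t => by simpa using hC t) φ.dense_range_toPreGNS ?_ v
  rintro _ ⟨b, rfl⟩
  simp only [inner_toPreGNS]
  exact hx (star b)

/-- In a primary representation, weak convergence to zero on one cyclic subspace propagates to the
whole representation space. -/
theorem IsPrimary.isWeaklyNull {σ : State A} (hσ : σ.IsPrimary) {a : ℝ → A} {C : ℝ}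
    (hC : ∀ t, ‖a t‖ ≤ C) {ξ : σ.GNSSpace} (hξ0 : ξ ≠ 0)
    (hξ : ∀ b, σ.gnsRep b ξ ∈ weaklyNullVectors fun t => σ.gnsRep (a t)) :
    σ.IsWeaklyNull a := by
  set S := weaklyNullVectors fun t => σ.gnsRep (a t)
  have hcl : IsClosed (S : Set σ.GNSSpace) :=
    isClosed_weaklyNullVectors fun t => (σ.norm_gnsRep_le _).trans (hC t)
  -- `S` is invariant under the commutant, but possibly not under `π(A)`. `K` is its largest
  -- `π(A)`-invariant subspace, so the projection onto `K` is central.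
  let K : Submodule ℂ σ.GNSSpace := ⨅ b : A, S.comap (σ.gnsRep b).toLinearMap
  have hmem {ζ : σ.GNSSpace} : ζ ∈ K ↔ ∀ b, σ.gnsRep b ζ ∈ S := by
    simp [K, Submodule.mem_iInf]
  have hKcl : IsClosed (K : Set σ.GNSSpace) := by
    simp only [K, Submodule.coe_iInf]
    exact isClosed_iInter fun b => hcl.preimage (σ.gnsRep b).continuous
  have : CompleteSpace K := hKcl.completeSpace_coe
  have hP : K.starProjection ∈ σ.inducedVN :=
    starProjection_mem_inducedVN K fun X hX ζ hζ => hmem.2 fun b => by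
      rw [← commute_gnsRep hX]
      exact mem_weaklyNullVectors_commutant hX (hmem.1 hζ b)
  have hP' : K.starProjection ∈ σ.inducedVN.commutant := by
    refine mem_commutant_inducedVN_iff.2 fun c => ?_
    have hcomp (c : A) : K.starProjection ∘L σ.gnsRep c ∘L K.starProjection =
        σ.gnsRep c ∘L K.starProjection := by
      refine isStarProjection_starProjection.isIdempotentElem.range_mem_invtSubmodule_iff.1 ?_
      rw [Submodule.range_starProjection]
      intro ζ hζ
      refine hmem.2 fun b => ?_
      simpa using hmem.1 hζ (b * c)
    have h1 := hcomp c
    -- Taking adjoints of the relation for `star c` gives `P π(c) P = P π(c)`, which together with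
    -- `h1` yields commutation.
    have h2 := congr(star $(hcomp (star c)))
    simp only [← mul_def, star_mul, isStarProjection_starProjection.isSelfAdjoint.star_eq, map_star,
      star_star, mul_assoc] at h1 h2
    exact h1.symm.trans h2
  obtain ⟨z, hz⟩ := hσ.subset ⟨hP, hP'⟩
  have hξK : K.starProjection ξ = ξ := Submodule.starProjection_eq_self_iff.2 (hmem.2 hξ)
  have hz1 : z = 1 := by
    rw [← hz] at hξK
    have : (z - 1) • ξ = 0 := by simpa [sub_smul, sub_eq_zero] using hξK
    exact sub_eq_zero.1 ((smul_eq_zero.1 this).resolve_right hξ0)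
  refine Submodule.eq_top_iff'.2 fun ζ => ?_
  have hζ : ζ ∈ K := by
    rw [← Submodule.starProjection_eq_self_iff, ← hz, hz1]
    simp
  simpa only [map_one, one_apply_eq_self] using hmem.1 hζ 1

/-- If the folia of `σ` and `ω` intersect and `σ` is primary, then weak convergence to zero in the
representation of `ω` implies weak convergence to zero in the representation of `σ`. -/
theorem IsWeaklyNull.of_mem_folium {σ ω φ : State A} {a : ℝ → A} (ha : ω.IsWeaklyNull a)
    {C : ℝ} (hC : ∀ t, ‖a t‖ ≤ C) (hσ : σ.IsPrimary) (hφσ : φ ∈ σ.folium) (hφω : φ ∈ ω.folium) :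
    σ.IsWeaklyNull a := by
  obtain ⟨s, ξ, hξ, hsum⟩ := exists_hasSum_of_mem_folium hφσ
  obtain ⟨i, hi⟩ : ∃ i, ξ i ≠ 0 := by
    by_contra! h
    have : HasSum (fun i => ‖ξ i‖ ^ 2) 0 := by simp [h, hasSum_zero]
    exact zero_ne_one (this.unique hξ)
  -- `φ (star b * b)` is the sum of all `‖π(b) ξ j‖²`, so it dominates the single term at `i`.
  have hle (b : A) : ‖σ.gnsRep b (ξ i)‖ ≤ ‖φ.toPositiveLinearMap.toPreGNS b‖ := by
    rw [← sq_le_sq₀ (norm_nonneg _) (norm_nonneg _)]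
    have hnorm : (fun j => ⟪ξ j, σ.gnsRep (star b * b) (ξ j)⟫_ℂ) =
        fun j => ((‖σ.gnsRep b (ξ j)‖ ^ 2 : ℝ) : ℂ) := by
      funext j
      rw [map_mul, mul_apply_eq_comp, inner_gnsRep, star_star, inner_self_eq_norm_sq_to_K]
      norm_cast
    have h1 := hsum (star b * b)
    rw [hnorm] at h1
    have h2 : HasSum (fun j => ‖σ.gnsRep b (ξ j)‖ ^ 2) (‖φ.toPositiveLinearMap.toPreGNS b‖ ^ 2) := by
      rw [← Complex.hasSum_ofReal]
      convert! h1 using 1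
      push_cast
      exact φ.toPositiveLinearMap.preGNS_norm_sq _
    exact le_hasSum h2 i fun _ _ => by positivity
  refine hσ.isWeaklyNull hC hi fun c η => ?_
  let f : A →ₗ[ℂ] ℂ :=
    { toFun b := ⟪η, σ.gnsRep b (ξ i)⟫_ℂ
      map_add' b c := by simp [inner_add_right]
      map_smul' z b := by simp [inner_smul_right] }
  have hf (b : A) : ‖f b‖ ≤ ‖η‖ * ‖φ.toPositiveLinearMap.toPreGNS b‖ :=
    (norm_inner_le_norm _ _).trans (mul_le_mul_of_nonneg_left (hle b) (norm_nonneg _))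
  -- The right factor `c` moves along the cyclic subspace of `ξ i`, and the left factor `b` is the
  -- test element in the GNS space of `φ`.
  have h := φ.tendsto_of_le_gns f hf (x := fun t => a t * c)
    (C := C * ‖φ.toPositiveLinearMap.toPreGNS c‖) (fun t => ?_) fun b => ?_
  · simpa [f] using h
  · have h1 := (le_opNorm (φ.gnsRep (a t)) (φ.toPositiveLinearMap.toPreGNS c)).trans
      (mul_le_mul_of_nonneg_right ((φ.norm_gnsRep_le _).trans (hC t)) (norm_nonneg _))
    simpa using h1
  · simpa only [mul_assoc] using ha.tendsto_of_mem_folium hC hφω b c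

/-- The deviation of a time-evolved observable from its expectation value is bounded. -/
theorem norm_sub_algebraMap_le (ω : State A) (α : Multiplicative ℝ →* (A ≃⋆ₐ[ℂ] A)) (a : A)
    (t : ℝ) : ‖α (Multiplicative.ofAdd t) a - algebraMap ℂ A (ω a)‖ ≤
      ‖a‖ + ‖algebraMap ℂ A (ω a)‖ :=
  (norm_sub_le _ _).trans (by
    gcongr
    exact NonUnitalStarAlgHom.norm_apply_le (α (Multiplicative.ofAdd t)) a)

/-- States whose folium meets the folium of a mixing state relax towards it. -/
theorem IsMixing.tendsto {σ ω φ : State A} {α : Multiplicative ℝ →* (A ≃⋆ₐ[ℂ] A)}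
    (hmix : ω.IsMixing α) (hsep : ω.HasSeparatingGNSVector) (hσ : σ.IsPrimary)
    (hφσ : φ ∈ σ.folium) (hφω : φ ∈ ω.folium) (a : A) :
    Tendsto (fun t : ℝ => σ (α (Multiplicative.ofAdd t) a)) atTop (𝓝 (ω a)) := by
  have hC := norm_sub_algebraMap_le ω α a
  have hω : ω.IsWeaklyNull fun t => α (Multiplicative.ofAdd t) a - algebraMap ℂ A (ω a) := by
    refine hsep.isWeaklyNull hC fun b => ?_
    have h := (hmix a b).sub_const (ω a * ω b)
    rw [sub_self] at h
    refine h.congr fun t => ?_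
    simp [mul_sub, Algebra.algebraMap_eq_smul_one]
  have h := Submodule.eq_top_iff'.1 (hω.of_mem_folium hC hσ hφσ hφω) σ.gnsVector σ.gnsVector
  simp only [inner_gnsVector_gnsRep] at h
  have h' := h.add_const (ω a)
  rw [zero_add] at h'
  refine h'.congr fun t => ?_
  have h1 : σ (1 : A) = 1 := σ.map_one'
  simp [Algebra.algebraMap_eq_smul_one, h1]

end State

/-! ### Commuting evolutions and the conclusion -/

theorem LocalQFT.timeEvolution_comm {d : ℕ} {A : Type*} [CStarAlgebra A] (Q : LocalQFT d A)
    (u w : Minkowski d) (s t : Multiplicative ℝ) (a : A) :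
    Q.timeEvolution u s (Q.timeEvolution w t a) = Q.timeEvolution w t (Q.timeEvolution u s a) := by
  simp only [LocalQFT.timeEvolution, MonoidHom.coe_mk, OneHom.coe_mk, ← StarAlgEquiv.mul_apply,
    ← map_mul, mul_comm]

theorem theorem3p4 {d : ℕ} (hd : 1 ≤ d) {A : Type*} [CStarAlgebra A] [PartialOrder A]
    [StarOrderedRing A] (Q : LocalQFT d A)
    (u w : Minkowski d) (hu : u.IsFutureTimelike) (hw : w.IsFutureTimelike)
    (huw : LinearIndependent ℝ ![u, w])
    (σ ω : State A) (hne : σ ≠ ω)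
    (hσ_inv : σ.IsInvariant (Q.timeEvolution u)) (hω_inv : ω.IsInvariant (Q.timeEvolution w))
    (hσ_prim : σ.IsPrimary) (hω_prim : ω.IsPrimary)
    (hσ_mix : σ.IsMixing (Q.timeEvolution u)) (hω_mix : ω.IsMixing (Q.timeEvolution w))
    (hσ_sep : σ.HasSeparatingGNSVector) (hω_sep : ω.HasSeparatingGNSVector) :
    State.AreDisjoint σ ω := by

  refine Set.eq_empty_iff_forall_notMem.2 fun φ hφ => hne ?_
  have hσω := hω_mix.tendsto hω_sep hσ_prim hφ.1 hφ.2
  have hωσ := hσ_mix.tendsto hσ_sep hω_prim hφ.2 hφ.1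
  have hinv : σ.IsInvariant (Q.timeEvolution w) := fun s a => by
    -- Relaxation of the observable `δ_{sw} a` has limit `σ(δ_{sw} a)`. Commuting the evolutions and
    -- using the `w`-invariance of `ω` removes `δ_{sw}`, so the limit is also `σ(a)`.
    refine tendsto_nhds_unique (hωσ (Q.timeEvolution w (Multiplicative.ofAdd s) a)) ?_
    simpa only [Q.timeEvolution_comm u w, hω_inv s] using hωσ a
  have heq (a : A) : σ a = ω a :=
    tendsto_nhds_unique (by simp only [hinv _ a, tendsto_const_nhds]) (hσω a)
  have h : σ.toPositiveLinearMap = ω.toPositiveLinearMap := DFunLike.ext _ _ heq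
  cases σ
  cases ω
  congr
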